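/- A density matrix on $\mathbb{C}^n$ is a positive semidefinite complex $n\times n$ matrix with unit trace. For a bipartite state $\rho_{AB}$ on $\mathbb{C}^A\otimes\mathbb{C}^B$, the conditional min-entropy $H_{\min}(A|B)_\rho$ is the largest real number $r$ such that $\rho_{AB}\le 2^{-r}\,(\mathbb{1}_A\otimes\tau_B)$ for some density matrix $\tau_B$. For two pairs of density matrices $(\rho_0,\rho_1)$ on a system $Q$ and $(\sigma_0,\sigma_1)$ on a system $Q'$, write $(\rho_0,\rho_1)\succeq(\sigma_0,\sigma_1)$ if, for every finite set $\mathcal{U}$ and every joint probability distribution $p$ on $\mathcal{U}\times\{0,1\}$, \[ H_{\min}(U|Q)_\rho\le H_{\min}(U|Q')_\sigma , \] where the two sides are evaluated on the classical-quantum states $\rho_{UQ}=\sum_{u\in\mathcal{U}}\sum_{x\in\{0,1\}}p(u,x)\,|u\rangle\langle u|\otimes\rho_x$ and $\sigma_{UQ'}=\sum_{u\in\mathcal{U}}\sum_{x\in\{0,1\}}p(u,x)\,|u\rangle\langle u|\otimes\sigma_x$, respectively. Proposition (fully quantum second-law-like statement for qubits). Let $\rho,\sigma,\omega$ be density matrices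 on $\mathbb{C}^2$. There exists a completely positive trace-preserving linear map $\Phi$ on the $2\times2$ complex matrices with $\Phi(\rho)=\sigma$ and $\Phi(\omega)=\omega$ if and only if $\rho\succeq_\omega\sigma$, that is, if and only if $(\rho,\omega)\succeq(\sigma,\omega)$. -/

import Mathlib

open scoped Matrix Kronecker ComplexOrder MatrixOrder Matrix.Norms.L2Operator CStarAlgebra

noncomputable section

/-- Density matrices on the Hilbert space `ℂⁿ`: positive semidefinite with unit trace. -/
def IsDensity {n : Type*} [Fintype n] (ρ : Matrix n n ℂ) : Prop :=
  ρ.PosSemidef ∧ ρ.trace = 1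

/-- A quantum channel (CPTP linear map) from operators on `ℂᵐ` to operators on `ℂⁿ`: a completely
positive linear map between the C⋆-algebras of matrices that preserves the trace. -/
structure QuantumChannel (m n : Type*) [Fintype m] [DecidableEq m] [Fintype n] [DecidableEq n]
    extends Matrix m m ℂ →CP Matrix n n ℂ where
  trace_map' (A : Matrix m m ℂ) : (toLinearMap A).trace = A.trace

/-- There is an `ω`-preserving transition from `ρ` to `σ`: a quantum channel `Φ` with
`Φ ρ = σ` and `Φ ω = ω`. -/
def ExistsPreservingTransition {n : Type*} [Fintype n] [DecidableEq n]
    (ω ρ σ : Matrix n n ℂ) : Prop :=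
  ∃ Φ : QuantumChannel n n, Φ.toLinearMap ρ = σ ∧ Φ.toLinearMap ω = ω

/-- The conditional min-entropy `H_min(A|B)` of a bipartite state `ρ` on `ℂᴬ ⊗ ℂᴮ`: the largest
real `r` such that `ρ ≤ 2 ^ (-r) • (1 ⊗ τ)` for some density matrix `τ` of the system `B`. -/
def condMinEntropy {A B : Type*} [Fintype A] [DecidableEq A] [Fintype B] [DecidableEq B]
    (ρ : Matrix (A × B) (A × B) ℂ) : ℝ :=
  sSup {r : ℝ | ∃ τ : Matrix B B ℂ, IsDensity τ ∧
    ρ ≤ (2 : ℝ) ^ (-r) • ((1 : Matrix A A ℂ) ⊗ₖ τ)}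

/-- The classical-quantum state `∑ u, ∑ x, p(u,x) |u⟩⟨u| ⊗ ρˣ` obtained by sending the second
component of the pair of random variables with joint law `p` through the channel `x ↦ ρˣ`. -/
def cqState {U X n : Type*} [Fintype U] [DecidableEq U] [Fintype X]
    (p : U × X → ℝ) (ρ : X → Matrix n n ℂ) : Matrix (U × n) (U × n) ℂ :=
  ∑ u, ∑ x, p (u, x) • (Matrix.single u u (1 : ℂ) ⊗ₖ ρ x)

/-- The information ordering `(ρ₀, ρ₁) ⪰ (σ₀, σ₁)`: for every finite set `U` and every joint
probability distribution `p` on `U × {0, 1}`, the conditional min-entropy of `U` given the quantum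
system is not larger for the first pair than for the second. -/
def MoreInformative {m n : Type*} [Fintype m] [DecidableEq m] [Fintype n] [DecidableEq n]
    (ρ₀ ρ₁ : Matrix m m ℂ) (σ₀ σ₁ : Matrix n n ℂ) : Prop :=
  ∀ (U : Type) [Fintype U] [DecidableEq U] (p : U × Fin 2 → ℝ), p ∈ stdSimplex ℝ (U × Fin 2) →
    condMinEntropy (cqState p ![ρ₀, ρ₁]) ≤ condMinEntropy (cqState p ![σ₀, σ₁])

/-- The thermal ordering `ρ ⪰_ω σ` with respect to the state `ω`. -/
def LessThermal {n : Type*} [Fintype n] [DecidableEq n] (ω ρ σ : Matrix n n ℂ) : Prop :=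
  MoreInformative ρ ω σ ω

end

/-!
A channel is positive and trace preserving, so it carries each operator `τ` witnessing a value of the
conditional min-entropy for the input pair to a witness for the output pair
(`QuantumChannel.moreInformative`). This is the easy direction.

Conversely, binary guessing problems determine the trace norms of all real combinations
`s • ρ + t • ω`. For a Hermitian `2 × 2` matrix of given trace and negative determinant, the trace
norm is a decreasing function of the determinant, and so the information ordering says that the
quadratic form `det (s • σ + t • ω)` dominates `det (s • ρ + t • ω)` wherever it is negative
(`MoreInformative.det_le`).

Let `ρ ≠ ω`. The line through `ρ` and `ω` meets the Bloch sphere in two pure states `|v⟩⟨v|` and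
`|w⟩⟨w|` (`exists_chord`). The affine map taking `ρ` to `σ` and fixing `ω` takes them to operators
`α` and `β` of unit trace, which the determinant condition makes states. It remains to find a
channel taking `|v⟩⟨v|` to `α` and `|w⟩⟨w|` to `β`. One exists once `α` and `β` have purifications
with the same overlap as `v` and `w`, because the isometry taking `v, w` to these purifications,
followed by a partial trace, is such a channel (`IsUnitPair.exists_channel`). Writing `α` and `β` as
mixtures of the same two pure states (`exists_common_mixture`) gives natural purifications, and
rotating the ancilla of one of them produces every real overlap up to the fidelity of `α` and `β`
(`exists_rotation`). That the overlap of `v` and `w` is at most this fidelity is the discriminant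
inequality for the determinant condition on the chord (`sq_le_of_form_le`).
-/

/-! ### Hermitian `2 × 2` matrices in Bloch coordinates -/

/-- The Hermitian matrix `t • 1 + x • σ₁ + y • σ₂ + z • σ₃`, with `σ₁, σ₂, σ₃` the Pauli matrices. -/
noncomputable def bloch (t x y z : ℝ) : Matrix (Fin 2) (Fin 2) ℂ :=
  !![(t + z : ℂ), x - y * Complex.I; x + y * Complex.I, t - z]

lemma Matrix.IsHermitian.exists_bloch {H : Matrix (Fin 2) (Fin 2) ℂ} (hH : H.IsHermitian) :
    ∃ t x y z : ℝ, H = bloch t x y z := by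
  refine ⟨((H 0 0).re + (H 1 1).re) / 2, (H 1 0).re, (H 1 0).im,
    ((H 0 0).re - (H 1 1).re) / 2, ?_⟩
  have h00 := congrArg Complex.im (hH.apply 0 0)
  have h11 := congrArg Complex.im (hH.apply 1 1)
  have h01 := hH.apply 0 1
  simp only [RCLike.star_def, Complex.conj_im] at h00 h11
  ext i j
  fin_cases i <;> fin_cases j <;> apply Complex.ext <;>
    simp [bloch, ← h01] <;> linarith

lemma bloch_trace (t x y z : ℝ) : (bloch t x y z).trace = ((2 * t : ℝ) : ℂ) := by
  simp [bloch, Matrix.trace_fin_two]; ring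

lemma bloch_det (t x y z : ℝ) :
    (bloch t x y z).det = ((t ^ 2 - x ^ 2 - y ^ 2 - z ^ 2 : ℝ) : ℂ) := by
  simp only [bloch, Matrix.det_fin_two_of]
  push_cast
  linear_combination (y ^ 2 : ℂ) * Complex.I_sq

lemma bloch_isHermitian (t x y z : ℝ) : (bloch t x y z).IsHermitian := by
  ext i j
  fin_cases i <;> fin_cases j <;> simp [bloch]
  ring

lemma bloch_add (t x y z t' x' y' z' : ℝ) :
    bloch t x y z + bloch t' x' y' z' = bloch (t + t') (x + x') (y + y') (z + z') := by
  ext i j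
  fin_cases i <;> fin_cases j <;> simp [bloch] <;> ring

lemma bloch_sub (t x y z t' x' y' z' : ℝ) :
    bloch t x y z - bloch t' x' y' z' = bloch (t - t') (x - x') (y - y') (z - z') := by
  ext i j
  fin_cases i <;> fin_cases j <;> simp [bloch] <;> ring

lemma bloch_smul (a t x y z : ℝ) :
    a • bloch t x y z = bloch (a * t) (a * x) (a * y) (a * z) := by
  ext i j
  fin_cases i <;> fin_cases j <;> simp [bloch] <;> ring

lemma bloch_posSemidef_iff (t x y z : ℝ) :
    (bloch t x y z).PosSemidef ↔ 0 ≤ t ∧ x ^ 2 + y ^ 2 + z ^ 2 ≤ t ^ 2 := by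
  constructor
  · intro h
    have h1 := h.trace_nonneg
    have h2 := h.det_nonneg
    rw [bloch_trace, Complex.zero_le_real] at h1
    rw [bloch_det, Complex.zero_le_real] at h2
    constructor <;> linarith
  · rintro ⟨ht, h⟩
    rcases ht.eq_or_lt with rfl | ht
    · have hx : x = 0 := by nlinarith [sq_nonneg x, sq_nonneg y, sq_nonneg z]
      have hy : y = 0 := by nlinarith [sq_nonneg x, sq_nonneg y, sq_nonneg z]
      have hz : z = 0 := by nlinarith [sq_nonneg x, sq_nonneg y, sq_nonneg z]
      have : bloch 0 x y z = 0 := by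
        subst hx hy hz
        ext i j
        fin_cases i <;> fin_cases j <;> simp [bloch]
      rw [this]
      exact .zero
    · -- Cayley–Hamilton expresses the matrix through its square and its determinant.
      have key : bloch t x y z = (1 / (2 * t)) • (bloch t x y z * (bloch t x y z)ᴴ +
          (t ^ 2 - x ^ 2 - y ^ 2 - z ^ 2) • (1 : Matrix (Fin 2) (Fin 2) ℂ)) := by
        have ht' : (t : ℂ) ≠ 0 := by exact_mod_cast ht.ne'
        rw [(bloch_isHermitian t x y z).eq]
        ext i j
        fin_cases i <;> fin_cases j <;> simp [bloch] <;>
          field_simp <;> ring_nf <;> simp only [Complex.I_sq] <;> ring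
      rw [key]
      refine Matrix.PosSemidef.smul (.add (Matrix.posSemidef_self_mul_conjTranspose _)
        (Matrix.PosSemidef.one.smul ?_)) (by positivity)
      linarith

lemma IsDensity.exists_bloch {ρ : Matrix (Fin 2) (Fin 2) ℂ} (h : IsDensity ρ) :
    ∃ x y z : ℝ, ρ = bloch (1 / 2) x y z ∧ x ^ 2 + y ^ 2 + z ^ 2 ≤ 1 / 4 := by
  obtain ⟨t, x, y, z, rfl⟩ := h.1.1.exists_bloch
  have h1 := h.2
  rw [bloch_trace] at h1
  have ht : t = 1 / 2 := by
    have : 2 * t = 1 := by exact_mod_cast h1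
    linarith
  subst ht
  have := ((bloch_posSemidef_iff _ _ _ _).1 h.1).2
  exact ⟨x, y, z, rfl, by linarith⟩

lemma isDensity_bloch {x y z : ℝ} (h : x ^ 2 + y ^ 2 + z ^ 2 ≤ 1 / 4) :
    IsDensity (bloch (1 / 2) x y z) :=
  ⟨(bloch_posSemidef_iff _ _ _ _).2 ⟨by norm_num, by linarith⟩, by rw [bloch_trace]; norm_num⟩

/-! ### Conditional min-entropy of classical-quantum states -/

lemma cqState_apply {U X n : Type*} [Fintype U] [DecidableEq U] [Fintype X]
    (p : U × X → ℝ) (ρ : X → Matrix n n ℂ) (u v : U) (i j : n) :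
    cqState p ρ (u, i) (v, j) = if u = v then (∑ x, p (u, x) • ρ x) i j else 0 := by
  simp only [cqState, Matrix.sum_apply, Matrix.smul_apply, Matrix.kroneckerMap_apply,
    Matrix.single_apply]
  split_ifs with h
  · subst h
    rw [Finset.sum_eq_single u]
    · simp
    · intro b _ hb
      simp [hb]
    · simp
  · refine Finset.sum_eq_zero fun w _ => Finset.sum_eq_zero fun x _ => ?_
    have : ¬ (w = u ∧ w = v) := fun hw => h (hw.1.symm.trans hw.2)
    simp [this]

/-- Because a classical-quantum state is block diagonal, the operator inequality defining the
conditional min-entropy decouples into one inequality for each classical value. -/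
lemma cqState_le_iff {U X n : Type*} [Fintype U] [DecidableEq U] [Fintype X] [Fintype n]
    [DecidableEq n] (p : U × X → ℝ) (ρ : X → Matrix n n ℂ) (c : ℝ) (τ : Matrix n n ℂ) :
    cqState p ρ ≤ c • ((1 : Matrix U U ℂ) ⊗ₖ τ) ↔ ∀ u, ∑ x, p (u, x) • ρ x ≤ c • τ := by
  simp only [Matrix.le_iff]
  constructor
  · intro h u
    convert h.submatrix (fun i : n => (u, i)) using 1
    ext i j
    simp [cqState_apply]
  · intro h
    have : c • ((1 : Matrix U U ℂ) ⊗ₖ τ) - cqState p ρ =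
        ∑ u, Matrix.single u u (1 : ℂ) ⊗ₖ (c • τ - ∑ x, p (u, x) • ρ x) := by
      ext ⟨u, i⟩ ⟨v, j⟩
      simp only [Matrix.sub_apply, Matrix.smul_apply, cqState_apply, Matrix.sum_apply (i := (u, i)),
        Matrix.kroneckerMap_apply, Matrix.single_apply, Matrix.one_apply]
      split_ifs with huv
      · subst huv
        rw [Finset.sum_eq_single u]
        · simp
        · intro b _ hb
          simp [hb]
        · simp
      · rw [Finset.sum_eq_zero]
        · simp
        · intro w _
          have : ¬ (w = u ∧ w = v) := fun hw => huv (hw.1.symm.trans hw.2)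
          simp [this]
    rw [this]
    refine Matrix.posSemidef_sum _ fun u _ => Matrix.PosSemidef.kronecker ?_ (h u)
    have : Matrix.single u u (1 : ℂ) = Matrix.diagonal (Pi.single u 1) := by
      rw [Matrix.diagonal_single]
    rw [this]
    refine Matrix.PosSemidef.diagonal ?_
    intro v
    by_cases hv : v = u
    · subst hv; simp
    · simp [hv]

lemma condMinEntropy_cqState {U X n : Type*} [Fintype U] [DecidableEq U] [Fintype X] [Fintype n]
    [DecidableEq n] (p : U × X → ℝ) (ρ : X → Matrix n n ℂ) :
    condMinEntropy (cqState p ρ) = sSup {r : ℝ | ∃ τ, IsDensity τ ∧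
      ∀ u, ∑ x, p (u, x) • ρ x ≤ (2 : ℝ) ^ (-r) • τ} := by
  simp only [condMinEntropy, cqState_le_iff]

lemma trace_re_mono {n : Type*} [Fintype n] {A B : Matrix n n ℂ} (h : A ≤ B) :
    A.trace.re ≤ B.trace.re := by
  have := (Complex.le_def.1 (Matrix.le_iff.1 h).trace_nonneg).1
  simp only [Matrix.trace_sub, Complex.sub_re, Complex.zero_re] at this
  linarith

/-- The exponents feasible in the definition of the conditional min-entropy are at most
`log₂ |U|`. -/
lemma bddAbove_feasible {U X n : Type*} [Fintype U] [Fintype X] [Fintype n]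
    {p : U × X → ℝ} (hp : p ∈ stdSimplex ℝ (U × X)) {ρ : X → Matrix n n ℂ}
    (hρ : ∀ x, IsDensity (ρ x)) :
    BddAbove {r : ℝ | ∃ τ, IsDensity τ ∧ ∀ u, ∑ x, p (u, x) • ρ x ≤ (2 : ℝ) ^ (-r) • τ} := by
  refine ⟨Real.logb 2 (Fintype.card U), ?_⟩
  rintro r ⟨τ, hτ, h⟩
  have h1 : ∀ u, ∑ x, p (u, x) ≤ (2 : ℝ) ^ (-r) := fun u => by
    have := trace_re_mono (h u)
    simpa [Matrix.trace_sum, Matrix.trace_smul, (hρ _).2, hτ.2] using this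
  have h2 : (1 : ℝ) ≤ Fintype.card U * (2 : ℝ) ^ (-r) := by
    rw [← hp.2, Fintype.sum_prod_type]
    simpa using Finset.sum_le_sum fun u (_ : u ∈ Finset.univ) => h1 u
  have h3 : (2 : ℝ) ^ r ≤ Fintype.card U := by
    rw [Real.rpow_neg zero_le_two, ← div_eq_mul_inv, le_div_iff₀ (by positivity), one_mul] at h2
    exact h2
  have hU : (0 : ℝ) < Fintype.card U := lt_of_lt_of_le (by positivity) h3
  exact (Real.le_logb_iff_rpow_le one_lt_two hU).2 h3

lemma two_rpow_neg_neg_logb {c : ℝ} (hc : 0 < c) : (2 : ℝ) ^ (-(-Real.logb 2 c)) = c := by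
  rw [neg_neg, Real.rpow_logb two_pos (by norm_num) hc]

lemma nonempty_feasible {U n : Type*} [Fintype U] [Fintype n]
    {p : U × Fin 2 → ℝ} (hp : p ∈ stdSimplex ℝ (U × Fin 2)) {ρ : Fin 2 → Matrix n n ℂ}
    (hρ : ∀ x, IsDensity (ρ x)) :
    {r : ℝ | ∃ τ, IsDensity τ ∧
      ∀ u, ∑ x, p (u, x) • ρ x ≤ (2 : ℝ) ^ (-r) • τ}.Nonempty := by
  refine ⟨-Real.logb 2 2, (1 / 2 : ℝ) • ∑ x, ρ x, ⟨?_, ?_⟩, fun u => ?_⟩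
  · exact (Matrix.posSemidef_sum _ fun x _ => (hρ x).1).smul (by norm_num)
  · simp [Matrix.trace_smul, (hρ _).2]; norm_num
  · rw [two_rpow_neg_neg_logb two_pos, smul_smul, Matrix.le_iff]
    norm_num only [one_smul]
    rw [← Finset.sum_sub_distrib]
    refine Matrix.posSemidef_sum _ fun x _ => ?_
    have h1 : p (u, x) ≤ 1 := by
      rw [← hp.2]
      exact Finset.single_le_sum (fun i _ => hp.1 i) (Finset.mem_univ _)
    have : ρ x - p (u, x) • ρ x = (1 - p (u, x)) • ρ x := by rw [sub_smul, one_smul]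
    rw [this]
    exact (hρ x).1.smul (by linarith)

lemma QuantumChannel.map_posSemidef {m n : Type*} [Fintype m] [DecidableEq m] [Fintype n]
    [DecidableEq n] (Φ : QuantumChannel m n) {A : Matrix m m ℂ} (hA : A.PosSemidef) :
    (Φ.toLinearMap A).PosSemidef :=
  Matrix.nonneg_iff_posSemidef.1
    (map_nonneg Φ.toCompletelyPositiveMap (Matrix.nonneg_iff_posSemidef.2 hA))

lemma QuantumChannel.map_isDensity {m n : Type*} [Fintype m] [DecidableEq m] [Fintype n]
    [DecidableEq n] (Φ : QuantumChannel m n) {A : Matrix m m ℂ} (hA : IsDensity A) :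
    IsDensity (Φ.toLinearMap A) :=
  ⟨Φ.map_posSemidef hA.1, (Φ.trace_map' A).trans hA.2⟩

/-- Data processing: a channel maps a witness `τ` for the input pair to a witness for the output
pair. -/
lemma QuantumChannel.moreInformative {m n : Type*} [Fintype m] [DecidableEq m] [Fintype n]
    [DecidableEq n] (Φ : QuantumChannel m n) {ρ₀ ρ₁ : Matrix m m ℂ} (h₀ : IsDensity ρ₀)
    (h₁ : IsDensity ρ₁) :
    MoreInformative ρ₀ ρ₁ (Φ.toLinearMap ρ₀) (Φ.toLinearMap ρ₁) := by
  intro U _ _ p hp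
  rw [condMinEntropy_cqState, condMinEntropy_cqState]
  refine csSup_le_csSup (bddAbove_feasible hp ?_) (nonempty_feasible hp ?_) ?_
  · intro x
    fin_cases x
    exacts [Φ.map_isDensity h₀, Φ.map_isDensity h₁]
  · intro x
    fin_cases x
    exacts [h₀, h₁]
  · rintro r ⟨τ, hτ, h⟩
    refine ⟨Φ.toLinearMap τ, Φ.map_isDensity hτ, fun u => ?_⟩
    have := Φ.map_posSemidef (Matrix.le_iff.1 (h u))
    rw [Matrix.le_iff]
    simpa [Fin.sum_univ_two, map_sub, map_add] using this

/-! ### From min-entropies to determinants -/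

lemma sum_sq_sub_le_sq_add {t t' x x' y y' z z' : ℝ} (ht : 0 ≤ t) (ht' : 0 ≤ t')
    (h : x ^ 2 + y ^ 2 + z ^ 2 ≤ t ^ 2) (h' : x' ^ 2 + y' ^ 2 + z' ^ 2 ≤ t' ^ 2) :
    (x - x') ^ 2 + (y - y') ^ 2 + (z - z') ^ 2 ≤ (t + t') ^ 2 := by
  have h1 : (x * x' + y * y' + z * z') ^ 2 ≤ (t * t') ^ 2 := by
    calc (x * x' + y * y' + z * z') ^ 2
        ≤ (x ^ 2 + y ^ 2 + z ^ 2) * (x' ^ 2 + y' ^ 2 + z' ^ 2) := by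
          nlinarith [sq_nonneg (x * y' - y * x'), sq_nonneg (x * z' - z * x'),
            sq_nonneg (y * z' - z * y')]
      _ ≤ t ^ 2 * t' ^ 2 := by gcongr
      _ = (t * t') ^ 2 := by ring
  have h2 := (abs_le_of_sq_le_sq' h1 (by positivity)).1
  nlinarith

/-- A common upper bound of two Hermitian matrices is at least as large in trace as the trace norm
of their difference demands; in Bloch coordinates this is the triangle inequality. -/
lemma trace_le_of_upper_bound {A B X : Matrix (Fin 2) (Fin 2) ℂ} {t x y z : ℝ}
    (hAB : A - B = bloch t x y z) (hA : A ≤ X) (hB : B ≤ X) :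
    A.trace.re + B.trace.re + 2 * √(x ^ 2 + y ^ 2 + z ^ 2) ≤ 2 * X.trace.re := by
  rw [Matrix.le_iff] at hA hB
  obtain ⟨t₁, x₁, y₁, z₁, h₁⟩ := hA.1.exists_bloch
  obtain ⟨t₂, x₂, y₂, z₂, h₂⟩ := hB.1.exists_bloch
  have hd : bloch t x y z = bloch (t₂ - t₁) (x₂ - x₁) (y₂ - y₁) (z₂ - z₁) := by
    rw [← bloch_sub, ← h₁, ← h₂, ← hAB]; abel
  have tr₁ := congrArg Matrix.trace h₁
  have tr₂ := congrArg Matrix.trace h₂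
  rw [bloch_trace, Matrix.trace_sub] at tr₁ tr₂
  rw [h₁, bloch_posSemidef_iff] at hA
  rw [h₂, bloch_posSemidef_iff] at hB
  have hx : x = x₂ - x₁ := by
    have := congrArg Complex.re (congrFun (congrFun hd 1) 0)
    simpa [bloch] using this
  have hy : y = y₂ - y₁ := by
    have := congrArg Complex.im (congrFun (congrFun hd 1) 0)
    simpa [bloch] using this
  have hz : z = z₂ - z₁ := by
    have e₁ := congrArg Complex.re (congrFun (congrFun hd 0) 0)
    have e₂ := congrArg Complex.re (congrFun (congrFun hd 1) 1)
    simp [bloch] at e₁ e₂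
    linarith
  have key : √(x ^ 2 + y ^ 2 + z ^ 2) ≤ t₂ + t₁ := by
    rw [Real.sqrt_le_left (by linarith [hA.1, hB.1]), hx, hy, hz]
    exact sum_sq_sub_le_sq_add hB.1 hA.1 hB.2 hA.2
  have r₁ := congrArg Complex.re tr₁
  have r₂ := congrArg Complex.re tr₂
  simp only [Complex.sub_re, Complex.ofReal_re] at r₁ r₂
  linarith

/-- Two Hermitian matrices have a common upper bound whose trace is close to optimal: the
candidate `((A + B) + m/2 + (tr H / m) H₀) / 2`, with `H₀` the traceless part of `H = A - B`, is
the exact optimum `(A + B + |H|) / 2` when `m` is the spectral gap of `H`. -/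
lemma exists_upper_bound {A B : Matrix (Fin 2) (Fin 2) ℂ} {t x y z m : ℝ}
    (hAB : A - B = bloch t x y z) (hm : |t| < m) (h : x ^ 2 + y ^ 2 + z ^ 2 ≤ m ^ 2) :
    ∃ X, A ≤ X ∧ B ≤ X ∧ X.trace = (A.trace + B.trace) / 2 + m := by
  have hm0 : 0 < m := (abs_nonneg t).trans_lt hm
  obtain ⟨hm1, hm2⟩ := abs_lt.1 hm
  have hp : (bloch m x y z).PosSemidef := (bloch_posSemidef_iff _ _ _ _).2 ⟨hm0.le, h⟩
  have hn : (bloch m (-x) (-y) (-z)).PosSemidef :=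
    (bloch_posSemidef_iff _ _ _ _).2 ⟨hm0.le, by linarith⟩
  refine ⟨(1 / 2 : ℝ) • (A + B + bloch m (t / m * x) (t / m * y) (t / m * z)), ?_, ?_, ?_⟩
  · rw [Matrix.le_iff]
    have : (1 / 2 : ℝ) • (A + B + bloch m (t / m * x) (t / m * y) (t / m * z)) - A =
        ((1 - t / m) / 2) • bloch m (-x) (-y) (-z) := by
      have e : (1 / 2 : ℝ) • (A + B + bloch m (t / m * x) (t / m * y) (t / m * z)) - A =
        (1 / 2 : ℝ) • (bloch m (t / m * x) (t / m * y) (t / m * z) - bloch t x y z) := by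
        rw [← hAB]; module
      rw [e, bloch_sub, bloch_smul, bloch_smul]
      congr 1 <;> field_simp <;> ring
    rw [this]
    refine hn.smul (div_nonneg (sub_nonneg.2 ?_) zero_le_two)
    rw [div_le_one hm0]; exact hm2.le
  · rw [Matrix.le_iff]
    have : (1 / 2 : ℝ) • (A + B + bloch m (t / m * x) (t / m * y) (t / m * z)) - B =
        ((1 + t / m) / 2) • bloch m x y z := by
      have e : (1 / 2 : ℝ) • (A + B + bloch m (t / m * x) (t / m * y) (t / m * z)) - B =
        (1 / 2 : ℝ) • (bloch m (t / m * x) (t / m * y) (t / m * z) + bloch t x y z) := by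
        rw [← hAB]; module
      rw [e, bloch_add, bloch_smul, bloch_smul]
      congr 1 <;> field_simp <;> ring
    rw [this]
    refine hp.smul (div_nonneg ?_ zero_le_two)
    have : -1 ≤ t / m := by rw [le_div_iff₀ hm0]; linarith
    linarith
  · simp only [Matrix.trace_smul, Matrix.trace_add, bloch_trace]
    rw [Complex.real_smul]
    push_cast
    ring

/-- Binary guessing problems detect the determinant: wherever the form `det (s • σ₀ + t • σ₁)` is
negative, it dominates `det (s • ρ₀ + t • ρ₁)`. -/
lemma MoreInformative.det_le {ρ₀ ρ₁ σ₀ σ₁ : Matrix (Fin 2) (Fin 2) ℂ}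
    (h : MoreInformative ρ₀ ρ₁ σ₀ σ₁) (hρ₀ : IsDensity ρ₀) (hρ₁ : IsDensity ρ₁)
    (hσ₀ : IsDensity σ₀) (hσ₁ : IsDensity σ₁) (s t : ℝ)
    (hneg : (s • σ₀ + t • σ₁).det.re < 0) :
    (s • ρ₀ + t • ρ₁).det.re ≤ (s • σ₀ + t • σ₁).det.re := by
  obtain ⟨a, b, c, hr₀, _⟩ := hρ₀.exists_bloch
  obtain ⟨a', b', c', hr₁, _⟩ := hρ₁.exists_bloch
  obtain ⟨d, e, f, hs₀, _⟩ := hσ₀.exists_bloch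
  obtain ⟨d', e', f', hs₁, _⟩ := hσ₁.exists_bloch
  -- The weights `s, t` are scaled by `k` so that `1/4 ± k s` and `1/4 ± k t` are probabilities.
  obtain ⟨k, hk, hks, hkt⟩ : ∃ k : ℝ, 0 < k ∧ |k * s| ≤ 1 / 4 ∧ |k * t| ≤ 1 / 4 := by
    have hpos : 0 < 4 * (|s| + |t| + 1) := by positivity
    refine ⟨1 / (4 * (|s| + |t| + 1)), by positivity, ?_, ?_⟩ <;>
    · rw [abs_mul, abs_of_pos (by positivity), div_mul_eq_mul_div, div_le_iff₀ hpos]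
      linarith [abs_nonneg s, abs_nonneg t]
  rw [abs_le] at hks hkt
  set p : Fin 2 × Fin 2 → ℝ := fun q => ![![1 / 4 + k * s, 1 / 4 + k * t],
    ![1 / 4 - k * s, 1 / 4 - k * t]] q.1 q.2 with hp_def
  have hp : p ∈ stdSimplex ℝ (Fin 2 × Fin 2) := by
    constructor
    · rintro ⟨u, x⟩
      fin_cases u <;> fin_cases x <;> simp [hp_def] <;> linarith
    · simp [Fintype.sum_prod_type, Fin.sum_univ_two, hp_def]; ring
  have hmono := h (Fin 2) p hp
  rw [condMinEntropy_cqState, condMinEntropy_cqState] at hmono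
  simp only [Fin.forall_fin_two, Fin.sum_univ_two, hp_def, Matrix.cons_val_zero,
    Matrix.cons_val_one, Matrix.cons_val_fin_one] at hmono
  have hdiff : ∀ A B : Matrix (Fin 2) (Fin 2) ℂ, ((1 / 4 + k * s) • A + (1 / 4 + k * t) • B) -
      ((1 / 4 - k * s) • A + (1 / 4 - k * t) • B) = (2 * k) • (s • A + t • B) := by
    intro A B; module
  have htr : ∀ A B : Matrix (Fin 2) (Fin 2) ℂ, IsDensity A → IsDensity B →
      ((1 / 4 + k * s) • A + (1 / 4 + k * t) • B).trace +
      ((1 / 4 - k * s) • A + (1 / 4 - k * t) • B).trace = 1 := by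
    intro A B hA hB
    simp only [Matrix.trace_add, Matrix.trace_smul, hA.2, hB.2, Complex.real_smul]
    push_cast
    ring
  have hdiffρ := hdiff ρ₀ ρ₁
  have hdiffσ := hdiff σ₀ σ₁
  have eρ : s • ρ₀ + t • ρ₁ = bloch (s * (1 / 2) + t * (1 / 2)) (s * a + t * a') (s * b + t * b')
      (s * c + t * c') := by rw [hr₀, hr₁, bloch_smul, bloch_smul, bloch_add]
  have eσ : s • σ₀ + t • σ₁ = bloch (s * (1 / 2) + t * (1 / 2)) (s * d + t * d') (s * e + t * e')
      (s * f + t * f') := by rw [hs₀, hs₁, bloch_smul, bloch_smul, bloch_add]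
  rw [eρ, bloch_smul] at hdiffρ
  rw [eσ, bloch_smul] at hdiffσ
  rw [eσ, bloch_det, Complex.ofReal_re] at hneg ⊢
  rw [eρ, bloch_det, Complex.ofReal_re]
  by_contra! hlt
  set T := s * (1 / 2) + t * (1 / 2)
  set X := s * a + t * a'
  set Y := s * b + t * b'
  set Z := s * c + t * c'
  set X' := s * d + t * d'
  set Y' := s * e + t * e'
  set Z' := s * f + t * f'
  have hmax : max |T| √(X ^ 2 + Y ^ 2 + Z ^ 2) < √(X' ^ 2 + Y' ^ 2 + Z' ^ 2) := by
    refine max_lt ?_ ?_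
    · rw [Real.lt_sqrt (abs_nonneg _), sq_abs]; linarith
    · exact Real.sqrt_lt_sqrt (by positivity) (by linarith)
  obtain ⟨m, hm, hm'⟩ := exists_between hmax
  obtain ⟨hmT, hmX⟩ := max_lt_iff.1 hm
  have hm0 : 0 < m := (abs_nonneg T).trans_lt hmT
  rw [Real.sqrt_lt' hm0] at hmX
  obtain ⟨W, hW₁, hW₂, hWtr⟩ := exists_upper_bound (m := 2 * k * m) hdiffρ
    (by rw [abs_mul, abs_of_pos (by positivity)]; gcongr)
    (by nlinarith [mul_pos hk hk, mul_lt_mul_of_pos_left hmX (mul_pos hk hk)])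
  rw [htr _ _ hρ₀ hρ₁] at hWtr
  have hw : (0 : ℝ) < 1 / 2 + 2 * k * m := by positivity
  have hWtr' : W.trace = ((1 / 2 + 2 * k * m : ℝ) : ℂ) := by rw [hWtr]; push_cast; ring
  have hW : W.PosSemidef := by
    have hM : ((1 / 4 + k * s) • ρ₀ + (1 / 4 + k * t) • ρ₁).PosSemidef :=
      (hρ₀.1.smul (by linarith)).add (hρ₁.1.smul (by linarith))
    simpa using (Matrix.le_iff.1 hW₁).add hM
  have hτ : IsDensity ((1 / 2 + 2 * k * m)⁻¹ • W) := by
    refine ⟨hW.smul (by positivity), ?_⟩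
    rw [Matrix.trace_smul, hWtr', Complex.real_smul, ← Complex.ofReal_mul,
      inv_mul_cancel₀ hw.ne', Complex.ofReal_one]
  have hdens : ∀ {A B : Matrix (Fin 2) (Fin 2) ℂ}, IsDensity A → IsDensity B →
      ∀ x, IsDensity (![A, B] x) := by
    intro A B hA hB x
    fin_cases x
    exacts [hA, hB]
  have hlow := le_csSup (bddAbove_feasible hp (hdens hρ₀ hρ₁))
    (a := -Real.logb 2 (1 / 2 + 2 * k * m)) ⟨_, hτ, by
      rw [two_rpow_neg_neg_logb hw, smul_inv_smul₀ hw.ne']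
      simp only [Fin.sum_univ_two]
      exact Fin.forall_fin_two.2 ⟨hW₁, hW₂⟩⟩
  have hup := csSup_le (a := -Real.logb 2 (1 / 2 + 2 * k * √(X' ^ 2 + Y' ^ 2 + Z' ^ 2)))
    (nonempty_feasible hp (hdens hσ₀ hσ₁)) (by
      rintro r ⟨τ, hτ, hr⟩
      simp only [Fin.forall_fin_two, Fin.sum_univ_two, hp_def, Matrix.cons_val_zero,
        Matrix.cons_val_one, Matrix.cons_val_fin_one] at hr
      have h1 := trace_le_of_upper_bound hdiffσ hr.1 hr.2
      rw [← Complex.add_re, htr _ _ hσ₀ hσ₁, Matrix.trace_smul, hτ.2] at h1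
      have h2 : (2 * k * X') ^ 2 + (2 * k * Y') ^ 2 + (2 * k * Z') ^ 2 =
          (2 * k) ^ 2 * (X' ^ 2 + Y' ^ 2 + Z' ^ 2) := by ring
      rw [h2, Real.sqrt_mul (by positivity), Real.sqrt_sq (by positivity)] at h1
      have h3 : 1 / 2 + 2 * k * √(X' ^ 2 + Y' ^ 2 + Z' ^ 2) ≤ (2 : ℝ) ^ (-r) := by
        rw [Complex.real_smul, mul_one, Complex.ofReal_re, Complex.one_re] at h1
        linarith
      have h4 := (Real.logb_le_iff_le_rpow one_lt_two (by positivity)).2 h3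
      linarith)
  simp only [Fin.forall_fin_two, Fin.sum_univ_two, hp_def, Matrix.cons_val_zero,
    Matrix.cons_val_one, Matrix.cons_val_fin_one] at hlow hup
  have hfin := (hlow.trans hmono).trans hup
  have : Real.logb 2 (1 / 2 + 2 * k * m) <
      Real.logb 2 (1 / 2 + 2 * k * √(X' ^ 2 + Y' ^ 2 + Z' ^ 2)) :=
    Real.logb_lt_logb one_lt_two hw (by gcongr)
  linarith

/-! ### Channels from Kraus operators and Gram matrices -/

/-- The channel with Kraus operators `K j`. -/
noncomputable def krausChannel {ι n : Type*} [Fintype ι] [Fintype n] [DecidableEq n]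
    (K : ι → Matrix n n ℂ) (hK : ∑ j, (K j)ᴴ * K j = 1) : QuantumChannel n n where
  toFun A := ∑ j, K j * A * (K j)ᴴ
  map_add' A B := by simp [mul_add, add_mul, Finset.sum_add_distrib]
  map_smul' c A := by simp [Finset.smul_sum]
  map_cstarMatrix_nonneg' k M hM := by
    -- Entrywise conjugation by `K j` is conjugation by the block-diagonal matrix `D j`.
    let D : ι → CStarMatrix (Fin k) (Fin k) (Matrix n n ℂ) :=
      fun j => CStarMatrix.ofMatrix (fun u v => if u = v then K j else 0)
    have h : M.map (fun A => ∑ j, K j * A * (K j)ᴴ) = ∑ j, D j * M * star (D j) := by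
      ext1 u v
      have happ : ∀ F : ι → CStarMatrix (Fin k) (Fin k) (Matrix n n ℂ),
          (∑ j, F j) u v = ∑ j, F j u v := fun F => Matrix.sum_apply u v _ F
      rw [happ, CStarMatrix.map_apply]
      refine Finset.sum_congr rfl fun j _ => ?_
      have hD : ∀ a b, D j a b = if a = b then K j else 0 := fun a b => rfl
      simp only [CStarMatrix.mul_apply, CStarMatrix.star_apply, hD, ite_mul, zero_mul,
        Finset.sum_ite_eq, Finset.mem_univ, if_true]
      rw [Finset.sum_eq_single v]
      · simp [Matrix.star_eq_conjTranspose]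
      · intro w _ hw
        simp [hw.symm]
      · simp
    change 0 ≤ M.map (fun A => ∑ j, K j * A * (K j)ᴴ)
    rw [h]
    exact Finset.sum_nonneg fun j _ => star_right_conjugate_nonneg hM _
  trace_map' A := by
    change (∑ j, K j * A * (K j)ᴴ).trace = A.trace
    calc (∑ j, K j * A * (K j)ᴴ).trace = ((∑ j, (K j)ᴴ * K j) * A).trace := by
          simp only [Matrix.trace_sum, Finset.sum_mul]
          exact Finset.sum_congr rfl fun j _ => by rw [Matrix.trace_mul_comm, mul_assoc]
      _ = A.trace := by rw [hK, one_mul]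

lemma krausChannel_apply {ι n : Type*} [Fintype ι] [Fintype n] [DecidableEq n]
    (K : ι → Matrix n n ℂ) (hK : ∑ j, (K j)ᴴ * K j = 1) (A : Matrix n n ℂ) :
    (krausChannel K hK).toLinearMap A = ∑ j, K j * A * (K j)ᴴ := rfl

/-- If the columns of the stacked matrix `X` have the same Gram matrix as those of the invertible
matrix `V`, then the isometry taking the latter to the former defines a channel. -/
lemma exists_channel_of_gram {ι n : Type*} [Fintype ι] [Fintype n] [DecidableEq n]
    (V : Matrix n n ℂ) (X : ι → Matrix n n ℂ) (hV : IsUnit V.det)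
    (hX : ∑ j, (X j)ᴴ * X j = Vᴴ * V) :
    ∃ Φ : QuantumChannel n n, ∀ E, Φ.toLinearMap (V * E * Vᴴ) = ∑ j, X j * E * (X j)ᴴ := by
  refine ⟨krausChannel (fun j => X j * V⁻¹) ?_, fun E => ?_⟩
  · have : ∀ j, (X j * V⁻¹)ᴴ * (X j * V⁻¹) = (V⁻¹)ᴴ * ((X j)ᴴ * X j) * V⁻¹ := fun j => by
      simp only [Matrix.conjTranspose_mul, mul_assoc]
    simp only [this, ← Finset.sum_mul, ← Finset.mul_sum, hX]
    rw [mul_assoc, mul_assoc, Matrix.mul_nonsing_inv V hV, mul_one, ← Matrix.conjTranspose_mul,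
      Matrix.mul_nonsing_inv V hV, Matrix.conjTranspose_one]
  · rw [krausChannel_apply]
    refine Finset.sum_congr rfl fun j _ => ?_
    have h1 : X j * V⁻¹ * V = X j := by rw [mul_assoc, Matrix.nonsing_inv_mul V hV, mul_one]
    calc X j * V⁻¹ * (V * E * Vᴴ) * (X j * V⁻¹)ᴴ
        = (X j * V⁻¹ * V) * E * (X j * V⁻¹ * V)ᴴ := by
          simp only [Matrix.conjTranspose_mul, mul_assoc]
      _ = X j * E * (X j)ᴴ := by rw [h1]

/-! ### Pairs of pure states -/

/-- The (unnormalized) projection `|v⟩⟨v|`. -/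
abbrev pureState (v : Fin 2 → ℂ) : Matrix (Fin 2) (Fin 2) ℂ := Matrix.vecMulVec v (star v)

/-- Two unit vectors of `ℂ²` whose inner product is the real number `c`, with `c ^ 2 < 1`. -/
structure IsUnitPair (v w : Fin 2 → ℂ) (c : ℝ) : Prop where
  left : star v ⬝ᵥ v = 1
  right : star w ⬝ᵥ w = 1
  inner : star v ⬝ᵥ w = c
  sq_lt : c ^ 2 < 1

lemma star_dotProduct_fin_two (v w : Fin 2 → ℂ) :
    star v ⬝ᵥ w = star (v 0) * w 0 + star (v 1) * w 1 := by
  simp [dotProduct, Fin.sum_univ_two]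

lemma star_dotProduct_swap {v w : Fin 2 → ℂ} {c : ℝ} (h : star v ⬝ᵥ w = c) :
    star w ⬝ᵥ v = c := by
  have h' := congrArg star h
  simp only [star_dotProduct_fin_two, star_add, star_mul, RCLike.star_def,
    Complex.conj_ofReal, Complex.conj_conj] at h' ⊢
  exact h'

lemma det_pureState_combination {v w : Fin 2 → ℂ} {c : ℝ} (hv : star v ⬝ᵥ v = 1)
    (hw : star w ⬝ᵥ w = 1) (hc : star v ⬝ᵥ w = c) (x y : ℝ) :
    (x • pureState v + y • pureState w).det = ((x * y * (1 - c ^ 2) : ℝ) : ℂ) := by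
  have hc' : star w ⬝ᵥ v = c := star_dotProduct_swap hc
  rw [star_dotProduct_fin_two] at hv hw hc hc'
  rw [Matrix.det_fin_two]
  simp only [Matrix.add_apply, Matrix.smul_apply, Matrix.vecMulVec_apply, Pi.star_apply,
    Complex.real_smul]
  push_cast
  linear_combination (x * y * (star (w 0) * w 0 + star (w 1) * w 1) : ℂ) * hv + (x * y : ℂ) * hw
    - (x * y * (star (w 0) * v 0 + star (w 1) * v 1) : ℂ) * hc - (x * y * c : ℂ) * hc'

/-- A pair of pure states with overlap `c` can be sent to a pair of mixtures of two pure states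
with overlap `g`, provided that some rotation (by the angle with cosine `C` and sine `S`) of the
ancilla gives the obvious purifications of these mixtures the overlap `c`. -/
lemma IsUnitPair.exists_channel {v w p q : Fin 2 → ℂ} {c g : ℝ} (hvw : IsUnitPair v w c)
    (hpq : IsUnitPair p q g) {A A' B B' C S : ℝ} (hA : A ^ 2 + A' ^ 2 = 1)
    (hB : B ^ 2 + B' ^ 2 = 1) (hCS : C ^ 2 + S ^ 2 = 1)
    (hc : C * (A * B + A' * B') + S * (g * (A' * B - A * B')) = c) :
    ∃ Φ : QuantumChannel (Fin 2) (Fin 2),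
      Φ.toLinearMap (pureState v) = A ^ 2 • pureState p + A' ^ 2 • pureState q ∧
      Φ.toLinearMap (pureState w) = B ^ 2 • pureState p + B' ^ 2 • pureState q := by
  let V : Matrix (Fin 2) (Fin 2) ℂ := !![v 0, w 0; v 1, w 1]
  -- The columns of the stacked matrices `X 0`, `X 1` purify the two mixtures.
  let X : Fin 2 → Matrix (Fin 2) (Fin 2) ℂ :=
    ![!![A * p 0, C * B * p 0 - S * B' * q 0; A * p 1, C * B * p 1 - S * B' * q 1],
      !![A' * q 0, S * B * p 0 + C * B' * q 0; A' * q 1, S * B * p 1 + C * B' * q 1]]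
  have v1 := hvw.left
  have w1 := hvw.right
  have vw := hvw.inner
  have wv := star_dotProduct_swap hvw.inner
  have p1 := hpq.left
  have q1 := hpq.right
  have pq := hpq.inner
  have qp := star_dotProduct_swap hpq.inner
  rw [star_dotProduct_fin_two] at v1 w1 vw wv p1 q1 pq qp
  simp only [RCLike.star_def] at v1 w1 vw wv p1 q1 pq qp
  have hA' : (A ^ 2 + A' ^ 2 : ℂ) = 1 := by exact_mod_cast hA
  have hB' : (B ^ 2 + B' ^ 2 : ℂ) = 1 := by exact_mod_cast hB
  have hCS' : (C ^ 2 + S ^ 2 : ℂ) = 1 := by exact_mod_cast hCS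
  have hc' : (C * (A * B + A' * B') + S * (g * (A' * B - A * B')) : ℂ) = c := by exact_mod_cast hc
  have hVV : Vᴴ * V = !![1, (c : ℂ); (c : ℂ), 1] := by
    ext i j
    fin_cases i <;> fin_cases j <;> simp [V, Matrix.mul_apply, Fin.sum_univ_two] <;> assumption
  have hV : IsUnit V.det := by
    rw [isUnit_iff_ne_zero]
    intro h
    have h1 := congrArg Matrix.det hVV
    rw [Matrix.det_mul, h, mul_zero, Matrix.det_fin_two_of] at h1
    have h2 : 1 - c ^ 2 = 0 := by
      have : ((1 - c ^ 2 : ℝ) : ℂ) = 0 := by push_cast; linear_combination -h1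
      exact_mod_cast this
    linarith [hvw.sq_lt]
  obtain ⟨Φ, hΦ⟩ := exists_channel_of_gram V X hV (by
    rw [hVV, Fin.sum_univ_two]
    ext i j
    fin_cases i <;> fin_cases j <;> simp [X, Matrix.mul_apply, Fin.sum_univ_two]
    · linear_combination (A ^ 2 : ℂ) * p1 + (A' ^ 2 : ℂ) * q1 + hA'
    · linear_combination (A * C * B : ℂ) * p1 + (A' * C * B' : ℂ) * q1 - (A * S * B' : ℂ) * pq +
        (A' * S * B : ℂ) * qp + hc'
    · linear_combination (A * C * B : ℂ) * p1 + (A' * C * B' : ℂ) * q1 - (A * S * B' : ℂ) * qp +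
        (A' * S * B : ℂ) * pq + hc'
    · linear_combination ((C ^ 2 + S ^ 2) * B ^ 2 : ℂ) * p1 + ((C ^ 2 + S ^ 2) * B' ^ 2 : ℂ) * q1 +
        (C ^ 2 + S ^ 2 : ℂ) * hB' + hCS')
  refine ⟨Φ, ?_, ?_⟩
  · have h1 : pureState v = V * !![1, 0; 0, 0] * Vᴴ := by
      ext i j
      fin_cases i <;> fin_cases j <;> simp [V, Matrix.vecMulVec_apply, Matrix.mul_apply]
    rw [h1, hΦ, Fin.sum_univ_two]
    ext i j
    fin_cases i <;> fin_cases j <;> simp [X, Matrix.vecMulVec_apply, Matrix.vecMul, dotProduct] <;> ring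
  · have h1 : pureState w = V * !![0, 0; 0, 1] * Vᴴ := by
      ext i j
      fin_cases i <;> fin_cases j <;> simp [V, Matrix.vecMulVec_apply, Matrix.mul_apply]
    rw [h1, hΦ, Fin.sum_univ_two]
    ext i j
    fin_cases i <;> fin_cases j <;> simp [X, Matrix.vecMulVec_apply, Matrix.vecMul, dotProduct]
    · linear_combination (B ^ 2 * p 0 * starRingEnd ℂ (p 0) + B' ^ 2 * q 0 * starRingEnd ℂ (q 0) : ℂ) * hCS'
    · linear_combination (B ^ 2 * p 0 * starRingEnd ℂ (p 1) + B' ^ 2 * q 0 * starRingEnd ℂ (q 1) : ℂ) * hCS'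
    · linear_combination (B ^ 2 * p 1 * starRingEnd ℂ (p 0) + B' ^ 2 * q 1 * starRingEnd ℂ (q 0) : ℂ) * hCS'
    · linear_combination (B ^ 2 * p 1 * starRingEnd ℂ (p 1) + B' ^ 2 * q 1 * starRingEnd ℂ (q 1) : ℂ) * hCS'

/-! ### Chords of the Bloch ball -/

lemma exists_unit_vector_bloch {x y z : ℝ} (h : x ^ 2 + y ^ 2 + z ^ 2 = 1 / 4) :
    ∃ v : Fin 2 → ℂ, star v ⬝ᵥ v = 1 ∧ pureState v = bloch (1 / 2) x y z := by
  suffices ∃ v : Fin 2 → ℂ, pureState v = bloch (1 / 2) x y z by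
    obtain ⟨v, hv⟩ := this
    refine ⟨v, ?_, hv⟩
    rw [dotProduct_comm, ← Matrix.trace_vecMulVec, show Matrix.vecMulVec v (star v) = _ from hv,
      bloch_trace]
    norm_num
  have hz : 0 ≤ 1 / 2 + z := by nlinarith [sq_nonneg x, sq_nonneg y]
  rcases hz.eq_or_lt with hz | hz
  · have hz' : z = -1 / 2 := by linarith
    have hx : x = 0 := by subst hz'; nlinarith [sq_nonneg x, sq_nonneg y]
    have hy : y = 0 := by subst hz'; nlinarith [sq_nonneg x, sq_nonneg y]
    refine ⟨![0, 1], ?_⟩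
    subst hx hy hz'
    ext i j
    fin_cases i <;> fin_cases j <;> simp [bloch, Matrix.vecMulVec_apply] <;> norm_num
  · have hr : ((√(1 / 2 + z) : ℝ) : ℂ) ≠ 0 := by
      exact_mod_cast (Real.sqrt_pos.2 hz).ne'
    have hr2 : ((√(1 / 2 + z) : ℝ) : ℂ) ^ 2 = 1 / 2 + z := by
      rw [← Complex.ofReal_pow, Real.sq_sqrt hz.le]; push_cast; ring
    have h' : (x ^ 2 + y ^ 2 + z ^ 2 : ℂ) = 1 / 4 := by
      have := congrArg (fun r : ℝ => (r : ℂ)) h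
      push_cast at this
      exact this
    have hs := Complex.conj_ofReal √(1 / 2 + z)
    generalize ((√(1 / 2 + z) : ℝ) : ℂ) = s at hr hr2 hs
    refine ⟨![s, (x + y * Complex.I) / s], ?_⟩
    ext i j
    fin_cases i <;> fin_cases j <;> simp [bloch, Matrix.vecMulVec_apply, hs]
    · linear_combination hr2
    · field_simp
      ring
    · field_simp
    · field_simp
      linear_combination 2 * h' - (1 - 2 * z : ℂ) * hr2 - (2 * y ^ 2 : ℂ) * Complex.I_sq

/-- A vector may be multiplied by a phase to make its inner product with another one real. -/
lemma exists_phase (z : ℂ) : ∃ u : ℂ, star u * u = 1 ∧ u * z = ‖z‖ := by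
  by_cases hz : z = 0
  · exact ⟨1, by simp [hz]⟩
  · have hn : (‖z‖ : ℂ) ≠ 0 := by exact_mod_cast norm_ne_zero_iff.2 hz
    have h := Complex.conj_mul' z
    refine ⟨star z / ‖z‖, ?_, ?_⟩
    · simp only [RCLike.star_def, map_div₀, Complex.conj_conj, Complex.conj_ofReal]
      field_simp
      linear_combination h
    · simp only [RCLike.star_def]
      field_simp
      linear_combination h

lemma exists_nonpos_root {k b e : ℝ} (hk : 0 < k) (he : e ≤ 0) :
    ∃ t ≤ 0, k * t ^ 2 + 2 * b * t + e = 0 := by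
  have hD : b ^ 2 ≤ b ^ 2 - k * e := by nlinarith
  have hs := Real.sq_sqrt ((sq_nonneg b).trans hD)
  have hb : -b ≤ √(b ^ 2 - k * e) := Real.le_sqrt_of_sq_le (by simpa using hD)
  refine ⟨(-b - √(b ^ 2 - k * e)) / k, div_nonpos_of_nonpos_of_nonneg (by linarith) hk.le, ?_⟩
  field_simp
  linear_combination hs

/-- The line through two distinct states of a qubit meets the Bloch sphere in two pure states, one
on either side of the segment joining them. -/
lemma exists_chord {ρ ω : Matrix (Fin 2) (Fin 2) ℂ} (hρ : IsDensity ρ) (hω : IsDensity ω)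
    (hne : ρ ≠ ω) :
    ∃ (v w : Fin 2 → ℂ) (c s t : ℝ), IsUnitPair v w c ∧ s ≤ 0 ∧ 1 ≤ t ∧
      pureState v = ω + s • (ρ - ω) ∧ pureState w = ω + t • (ρ - ω) := by
  obtain ⟨x', y', z', rfl, h'⟩ := hρ.exists_bloch
  obtain ⟨x, y, z, rfl, h⟩ := hω.exists_bloch
  have hk : 0 < (x' - x) ^ 2 + (y' - y) ^ 2 + (z' - z) ^ 2 := by
    by_contra! hle
    have hx : x' = x := by nlinarith [sq_nonneg (x' - x), sq_nonneg (y' - y), sq_nonneg (z' - z)]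
    have hy : y' = y := by nlinarith [sq_nonneg (x' - x), sq_nonneg (y' - y), sq_nonneg (z' - z)]
    have hz : z' = z := by nlinarith [sq_nonneg (x' - x), sq_nonneg (y' - y), sq_nonneg (z' - z)]
    exact hne (by rw [hx, hy, hz])
  obtain ⟨s, hs, es⟩ := exists_nonpos_root
    (b := x * (x' - x) + y * (y' - y) + z * (z' - z)) hk (sub_nonpos.2 h)
  obtain ⟨t, ht, et⟩ := exists_nonpos_root
    (b := -(x' * (x' - x) + y' * (y' - y) + z' * (z' - z))) hk (sub_nonpos.2 h')
  have line : ∀ r : ℝ, bloch (1 / 2) x y z + r • (bloch (1 / 2) x' y' z' - bloch (1 / 2) x y z) =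
      bloch (1 / 2) (x + r * (x' - x)) (y + r * (y' - y)) (z + r * (z' - z)) := by
    intro r
    rw [bloch_sub, bloch_smul, bloch_add]
    congr 1; ring
  obtain ⟨v, hv, ev⟩ := exists_unit_vector_bloch
    (x := x + s * (x' - x)) (y := y + s * (y' - y)) (z := z + s * (z' - z)) (by linarith)
  obtain ⟨w, hw, ew⟩ := exists_unit_vector_bloch (x := x + (1 - t) * (x' - x))
    (y := y + (1 - t) * (y' - y)) (z := z + (1 - t) * (z' - z)) (by linarith)
  obtain ⟨u, hu, huc⟩ := exists_phase (star v ⬝ᵥ w)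
  have huw : pureState (u • w) = pureState w := by
    rw [pureState, star_smul, Matrix.smul_vecMulVec, Matrix.vecMulVec_smul, smul_smul,
      mul_comm, hu, one_smul]
  have hw' : star (u • w) ⬝ᵥ (u • w) = 1 := by
    rw [star_smul, smul_dotProduct, dotProduct_smul, hw, smul_smul, hu, one_smul]
  have hi : star v ⬝ᵥ (u • w) = (‖star v ⬝ᵥ w‖ : ℝ) := by
    rw [dotProduct_smul, smul_eq_mul, huc]
  refine ⟨v, u • w, ‖star v ⬝ᵥ w‖, s, 1 - t, ⟨hv, hw', hi, ?_⟩, hs, by linarith, ?_, ?_⟩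
  · -- The difference of the two pure states is traceless and nonzero, so its determinant is
    -- negative.
    have hdet := det_pureState_combination hv hw' hi 1 (-1)
    rw [huw, ev, ew, bloch_smul, bloch_smul, bloch_add, bloch_det] at hdet
    have hdet' := Complex.ofReal_injective hdet
    have hst : 0 < (1 - t - s) ^ 2 := by nlinarith
    nlinarith [mul_pos hst hk]
  · rw [ev, line]
  · rw [huw, ew, line]

/-- Any two qubit states are mixtures of the same two pure states. -/
lemma exists_common_mixture {α β : Matrix (Fin 2) (Fin 2) ℂ} (hα : IsDensity α)
    (hβ : IsDensity β) :
    ∃ (p q : Fin 2 → ℂ) (g a b : ℝ), IsUnitPair p q g ∧ 0 ≤ a ∧ a ≤ 1 ∧ 0 ≤ b ∧ b ≤ 1 ∧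
      α = a • pureState p + (1 - a) • pureState q ∧
      β = b • pureState p + (1 - b) • pureState q := by
  -- If the states coincide, any chord through their common value serves.
  obtain ⟨γ, hγ, hne, hγβ⟩ : ∃ γ, IsDensity γ ∧ γ ≠ β ∧ (α = β ∨ α = γ) := by
    by_cases h : α = β
    · by_cases h0 : β = bloch (1 / 2) 0 0 0
      · refine ⟨bloch (1 / 2) (1 / 2) 0 0, isDensity_bloch (by norm_num), ?_, .inl h⟩
        intro h1
        rw [h0] at h1
        have := congrArg Complex.re (congrFun (congrFun h1 1) 0)
        simp [bloch] at this
      · exact ⟨bloch (1 / 2) 0 0 0, isDensity_bloch (by norm_num), fun h => h0 h.symm, .inl h⟩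
    · exact ⟨α, hα, h, .inr rfl⟩
  obtain ⟨p, q, g, s, t, hpq, hs, ht, hp, hq⟩ := exists_chord hγ hβ hne
  have hts : 0 < t - s := by linarith
  have hb : β = (t / (t - s)) • pureState p + (1 - t / (t - s)) • pureState q := by
    rw [hp, hq]
    match_scalars <;> field_simp <;> ring
  have hc : γ = ((t - 1) / (t - s)) • pureState p + (1 - (t - 1) / (t - s)) • pureState q := by
    rw [hp, hq]
    match_scalars <;> field_simp <;> ring
  have h1 : 0 ≤ t / (t - s) := by positivity
  have h2 : t / (t - s) ≤ 1 := by rw [div_le_one hts]; linarith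
  have h3 : 0 ≤ (t - 1) / (t - s) := div_nonneg (by linarith) hts.le
  have h4 : (t - 1) / (t - s) ≤ 1 := by rw [div_le_one hts]; linarith
  rcases hγβ with h | h
  · exact ⟨p, q, g, _, _, hpq, h1, h2, h1, h2, h.trans hb, hb⟩
  · exact ⟨p, q, g, _, _, hpq, h3, h4, h1, h2, h.trans hc, hb⟩

/-! ### The overlap condition -/

/-- If the form `(1 - g²) (x a + y b) (x a' + y b')` dominates `(1 - c²) x y` wherever it is
negative, then `c` is at most the fidelity of the two mixtures, with weights `a, a'` and `b, b'`, of
a pair of pure states with overlap `g`; here `a = A²` and so on. The bound is the discriminant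
inequality for the difference of the two forms, evaluated at `y = -1`. -/
lemma sq_le_of_form_le {c g A A' B B' : ℝ} (hg : g ^ 2 < 1) (hc : c ^ 2 < 1)
    (hA0 : 0 ≤ A) (hA0' : 0 ≤ A') (hB0 : 0 ≤ B) (hB0' : 0 ≤ B')
    (hA : A ^ 2 + A' ^ 2 = 1) (hB : B ^ 2 + B' ^ 2 = 1)
    (h : ∀ x y : ℝ, (x * A ^ 2 + y * B ^ 2) * (x * A' ^ 2 + y * B' ^ 2) * (1 - g ^ 2) < 0 →
      x * y * (1 - c ^ 2) ≤
        (x * A ^ 2 + y * B ^ 2) * (x * A' ^ 2 + y * B' ^ 2) * (1 - g ^ 2)) :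
    c ^ 2 ≤ (A * B + A' * B') ^ 2 + (g * (A' * B - A * B')) ^ 2 := by
  set G := 1 - g ^ 2 with hG
  have hG0 : 0 < G := by linarith
  set K := G * (A ^ 2 * B' ^ 2 + A' ^ 2 * B ^ 2) - (1 - c ^ 2) with hK
  suffices hK' : K ≤ 2 * G * (A * A' * B * B') by
    have h1 : (A ^ 2 + A' ^ 2) * (B ^ 2 + B' ^ 2) = 1 := by rw [hA, hB, one_mul]
    have h2 : g ^ 2 = 1 - G := by rw [hG]; ring
    rw [mul_pow, h2]
    linarith
  have hprod : 0 ≤ 2 * G * (A * A' * B * B') := by positivity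
  by_cases hK0 : K ≤ 0
  · linarith
  push Not at hK0
  have hquad : ∀ x : ℝ, 0 ≤ (G * A ^ 2 * A' ^ 2) * (x * x) + (-K) * x + G * B ^ 2 * B' ^ 2 := by
    intro x
    rcases le_or_gt x 0 with hx | hx
    · have : 0 ≤ -K * x := mul_nonneg_of_nonpos_of_nonpos (by linarith) hx
      have := mul_self_nonneg x
      positivity
    · have h1 := h x (-1)
      have h2 : 0 ≤ x * (1 - c ^ 2) := mul_nonneg hx.le (by linarith)
      by_cases h3 : (x * A ^ 2 + -1 * B ^ 2) * (x * A' ^ 2 + -1 * B' ^ 2) * G < 0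
      · have := h1 h3
        rw [hK]; linarith
      · rw [hK]; linarith
  have hd := discrim_le_zero hquad
  rw [discrim] at hd
  exact (abs_le_of_sq_le_sq' (by linarith) hprod).2

lemma exists_rotation {P R c : ℝ} (h : c ^ 2 ≤ P ^ 2 + R ^ 2) :
    ∃ C S : ℝ, C ^ 2 + S ^ 2 = 1 ∧ C * P + S * R = c := by
  by_cases h0 : P ^ 2 + R ^ 2 = 0
  · have hP : P = 0 := by nlinarith [sq_nonneg P, sq_nonneg R]
    have hR : R = 0 := by nlinarith [sq_nonneg P, sq_nonneg R]
    have hc : c = 0 := by nlinarith [sq_nonneg c]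
    exact ⟨1, 0, by norm_num, by simp [hP, hc]⟩
  · have hs := Real.sq_sqrt (sub_nonneg.2 h)
    set k := √(P ^ 2 + R ^ 2 - c ^ 2)
    refine ⟨(c * P - k * R) / (P ^ 2 + R ^ 2), (c * R + k * P) / (P ^ 2 + R ^ 2), ?_, ?_⟩
    · field_simp
      linear_combination (P ^ 2 + R ^ 2) * hs
    · field_simp
      ring

/-! ### The transition -/

/-- The determinant condition suffices for a transition when the initial state is not `ω`. -/
lemma exists_preserving_channel {ω ρ σ : Matrix (Fin 2) (Fin 2) ℂ} (hω : IsDensity ω)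
    (hρ : IsDensity ρ) (hσ : IsDensity σ) (hne : ρ ≠ ω)
    (hdet : ∀ s t : ℝ, (s • σ + t • ω).det.re < 0 →
      (s • ρ + t • ω).det.re ≤ (s • σ + t • ω).det.re) :
    ExistsPreservingTransition ω ρ σ := by
  obtain ⟨v, w, c, s, t, hvw, hs, ht, hv, hw⟩ := exists_chord hρ hω hne
  have hst : t - s ≠ 0 := by linarith
  -- The form on the chord through `σ, ω`, at the images of the endpoints of the other chord.
  have hform : ∀ x y : ℝ,
      (x • (ω + s • (σ - ω)) + y • (ω + t • (σ - ω))).det.re < 0 →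
      x * y * (1 - c ^ 2) ≤ (x • (ω + s • (σ - ω)) + y • (ω + t • (σ - ω))).det.re := by
    intro x y hneg
    have e : ∀ τ : Matrix (Fin 2) (Fin 2) ℂ, x • (ω + s • (τ - ω)) + y • (ω + t • (τ - ω)) =
        (x * s + y * t) • τ + (x + y - (x * s + y * t)) • ω := by
      intro τ; module
    have h1 := det_pureState_combination hvw.left hvw.right hvw.inner x y
    rw [hv, hw, e] at h1
    rw [e] at hneg ⊢
    have := hdet _ _ hneg
    rwa [h1, Complex.ofReal_re] at this
  have hdens : ∀ r : ℝ, 0 ≤ (ω + r • (σ - ω)).det.re → IsDensity (ω + r • (σ - ω)) := by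
    intro r hr
    obtain ⟨x', y', z', rfl, _⟩ := hσ.exists_bloch
    obtain ⟨x, y, z, rfl, _⟩ := hω.exists_bloch
    rw [bloch_sub, bloch_smul, bloch_add] at hr ⊢
    rw [bloch_det, Complex.ofReal_re] at hr
    ring_nf at hr ⊢
    exact isDensity_bloch (by linarith)
  have hα : IsDensity (ω + s • (σ - ω)) := hdens s <| by
    by_contra! hneg
    have := hform 1 0
    simp only [one_smul, zero_smul, add_zero, mul_zero, zero_mul] at this
    exact absurd (this hneg) (not_le.2 hneg)
  have hβ : IsDensity (ω + t • (σ - ω)) := hdens t <| by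
    by_contra! hneg
    have := hform 0 1
    simp only [one_smul, zero_smul, zero_add, zero_mul] at this
    exact absurd (this hneg) (not_le.2 hneg)
  obtain ⟨p, q, g, a, b, hpq, ha0, ha1, hb0, hb1, ea, eb⟩ := exists_common_mixture hα hβ
  have hA := Real.sq_sqrt ha0
  have hA' := Real.sq_sqrt (sub_nonneg.2 ha1)
  have hB := Real.sq_sqrt hb0
  have hB' := Real.sq_sqrt (sub_nonneg.2 hb1)
  obtain ⟨C, S, hCS, hc⟩ := exists_rotation (sq_le_of_form_le (c := c) (g := g) (A := √a)
    (A' := √(1 - a)) (B := √b) (B' := √(1 - b)) hpq.sq_lt hvw.sq_lt (Real.sqrt_nonneg _)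
    (Real.sqrt_nonneg _) (Real.sqrt_nonneg _) (Real.sqrt_nonneg _) (by linarith) (by linarith) (by
      intro x y
      have e : x • (ω + s • (σ - ω)) + y • (ω + t • (σ - ω)) =
          (x * a + y * b) • pureState p + (x * (1 - a) + y * (1 - b)) • pureState q := by
        rw [ea, eb]; module
      have := hform x y
      rw [e, det_pureState_combination hpq.left hpq.right hpq.inner, Complex.ofReal_re] at this
      rw [hA, hA', hB, hB']
      exact this))
  obtain ⟨Φ, hΦv, hΦw⟩ := hvw.exists_channel hpq (by linarith) (by linarith) hCS hc
  rw [hA, hA', ← ea, hv] at hΦv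
  rw [hB, hB', ← eb, hw] at hΦw
  have hreal : ∀ (r : ℝ) (τ : Matrix (Fin 2) (Fin 2) ℂ),
      Φ.toLinearMap (r • τ) = r • Φ.toLinearMap τ := fun r τ => by
    rw [← Complex.coe_smul, map_smul, Complex.coe_smul]
  rw [map_add, hreal, map_sub] at hΦv hΦw
  have hdiff : Φ.toLinearMap ρ - Φ.toLinearMap ω = σ - ω := by
    have h1 : (t - s) • (Φ.toLinearMap ρ - Φ.toLinearMap ω) = (t - s) • (σ - ω) := by
      have h2 := congrArg₂ (· - ·) hΦw hΦv
      simp only [add_sub_add_left_eq_sub, ← sub_smul] at h2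
      exact h2
    exact smul_right_injective _ hst h1
  rw [hdiff] at hΦv
  have hΦω := add_right_cancel hΦv
  rw [hΦω] at hdiff
  exact ⟨Φ, sub_left_injective hdiff, hΦω⟩

theorem proposition1 (ω ρ σ : Matrix (Fin 2) (Fin 2) ℂ)
    (hω : IsDensity ω) (hρ : IsDensity ρ) (hσ : IsDensity σ) :
    ExistsPreservingTransition ω ρ σ ↔ LessThermal ω ρ σ := by
  constructor
  · rintro ⟨Φ, rfl, hΦω⟩
    have := Φ.moreInformative hρ hω
    rwa [hΦω] at this
  · intro h
    have hdet := MoreInformative.det_le h hρ hω hσ hω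
    by_cases hne : ρ = ω
    · -- The form of the initial pair vanishes at `(1, -1)`, which forces `σ = ω`.
      subst hne
      have hσρ : σ = ρ := by
        by_contra hσne
        obtain ⟨x', y', z', rfl, _⟩ := hσ.exists_bloch
        obtain ⟨x, y, z, rfl, _⟩ := hρ.exists_bloch
        have h1 := hdet 1 (-1)
        rw [← add_smul, add_neg_cancel, zero_smul, Matrix.det_zero, bloch_smul, bloch_smul,
          bloch_add, bloch_det, Complex.ofReal_re, Complex.zero_re] at h1
        by_cases hneg : (1 * (1 / 2) + -1 * (1 / 2)) ^ 2 - (1 * x' + -1 * x) ^ 2 -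
            (1 * y' + -1 * y) ^ 2 - (1 * z' + -1 * z) ^ 2 < 0
        · linarith [h1 hneg]
        · have hx : x' = x := by
            nlinarith [sq_nonneg (x' - x), sq_nonneg (y' - y), sq_nonneg (z' - z)]
          have hy : y' = y := by
            nlinarith [sq_nonneg (x' - x), sq_nonneg (y' - y), sq_nonneg (z' - z)]
          have hz : z' = z := by
            nlinarith [sq_nonneg (x' - x), sq_nonneg (y' - y), sq_nonneg (z' - z)]
          exact hσne (by rw [hx, hy, hz])
      subst hσρ
      refine ⟨krausChannel (fun _ : Unit => 1) (by simp), ?_, ?_⟩ <;>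
        simp [krausChannel_apply]
    · exact exists_preserving_channel hω hρ hσ hne hdet
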